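/- Let $m \ge 0$ and $n \ge 0$ be integers. The binary-coin construction is the random matrix $\Pi = (\mathbf z_1,\dots,\mathbf z_n) \in \mathbb{R}^{m\times n}$ whose columns $\mathbf z_1,\dots,\mathbf z_n$ are independent, each uniformly distributed on $\frac{1}{\sqrt m}\{1,-1\}^m$; the spherical construction is the random matrix $\Pi = (\mathbf z_1,\dots,\mathbf z_n) \in \mathbb{R}^{m\times n}$ whose columns are independent, each uniformly distributed on the Euclidean unit sphere $\mathbb{S}^{m-1} \subset \mathbb{R}^m$. Let $0<\varepsilon<1$ and $0<\delta<1$, and suppose that $m \ge 64\,\varepsilon^{-2}\log(2/\delta)$ (natural logarithm; in particular $m \ge 1$). Then for both constructions, the law of $\Pi$ is a probability distribution on $\mathbb{R}^{m\times n}$ and, for every fixed $x \in \mathbb{R}^n$, $$\mathbb{P}\left( (1-\varepsilon)\|x\|_2^2 \le \|\Pi x\|_2^2 \le (1+\varepsilon)\|x\|_2^2 \right) \ge 1-\delta .$$ Moreover, the smallest such dimension is $O(\varepsilon^{-2}\log(1/\delta))$: there is an absolute constant $C$ such that $\lceil 64\,\varepsilon^{-2}\log(2/\delta) \rceil \le C\,\varepsilon^{-2}\log(1/\delta)$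 for all $0<\varepsilon,\delta<1/2$. Thus both constructions satisfy the Johnson–Lindenstrauss lemma. -/

import Mathlib

open MeasureTheory ProbabilityTheory

noncomputable section

namespace JL

/-- The product (Borel) σ-algebra on real matrices. -/
instance matrixMeasurableSpace (m n : ℕ) : MeasurableSpace (Matrix (Fin m) (Fin n) ℝ) :=
  inferInstanceAs (MeasurableSpace (Fin m → Fin n → ℝ))

/-- The uniform probability distribution `U(S^{m-1})` on the Euclidean unit sphere of `ℝ^m`, as a
measure on `ℝ^m`: the rotation-invariant surface measure, divided by its total mass
(for `m ≥ 1`). -/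
def uniformSphere (m : ℕ) : Measure (EuclideanSpace ℝ (Fin m)) :=
  Measure.map Subtype.val
    (((volume : Measure (EuclideanSpace ℝ (Fin m))).toSphere Set.univ)⁻¹ •
      (volume : Measure (EuclideanSpace ℝ (Fin m))).toSphere)

/-- The set of sign vectors `{1, -1}^m` in `ℝ^m`. -/
def signCube (m : ℕ) : Set (EuclideanSpace ℝ (Fin m)) :=
  {v | ∀ i, v i = 1 ∨ v i = -1}

/-- The distribution `(1/√m) U({1, -1}^m)`: the law of `v / √m` for `v` uniform on `{1, -1}^m`. -/
def uniformScaledCube (m : ℕ) : Measure (EuclideanSpace ℝ (Fin m)) :=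
  Measure.map (fun v => (1 / Real.sqrt m) • v) (uniformOn (signCube m))

/-- The `m × n` matrix with columns `z_1, …, z_n`. -/
def ofColumns {m n : ℕ} (z : Fin n → EuclideanSpace ℝ (Fin m)) : Matrix (Fin m) (Fin n) ℝ :=
  Matrix.of fun i j => z j i

/-- The law of the random `m × n` matrix whose columns are independent with common law `P`. -/
def iidColumns {m : ℕ} (n : ℕ) (P : Measure (EuclideanSpace ℝ (Fin m))) :
    Measure (Matrix (Fin m) (Fin n) ℝ) :=
  Measure.map ofColumns (Measure.pi fun _ : Fin n => P)

/-- Spherical construction: independent columns, each uniform on the sphere `S^{m-1}`. -/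
def sphericalConstruction (m n : ℕ) : Measure (Matrix (Fin m) (Fin n) ℝ) :=
  iidColumns n (uniformSphere m)

/-- Binary-coin construction: independent columns, each uniform on `(1/√m) {1, -1}^m`. -/
def binaryCoinConstruction (m n : ℕ) : Measure (Matrix (Fin m) (Fin n) ℝ) :=
  iidColumns n (uniformScaledCube m)

/-- `D` is a Johnson–Lindenstrauss distribution with parameters `ε, δ`: a probability distribution
on `m × n` matrices such that for every fixed `x ∈ ℝ^n`, with probability at least `1 - δ`,
`(1 - ε) ‖x‖² ≤ ‖M x‖² ≤ (1 + ε) ‖x‖²` (Euclidean norms). -/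
def IsJLDistribution {m n : ℕ} (ε δ : ℝ) (D : Measure (Matrix (Fin m) (Fin n) ℝ)) : Prop :=
  IsProbabilityMeasure D ∧
    ∀ x : EuclideanSpace ℝ (Fin n),
      1 - δ ≤ D.real {M | ‖(WithLp.toLp 2 (M.mulVec x.ofLp) : EuclideanSpace ℝ (Fin m))‖ ^ 2 ∈
        Set.Icc ((1 - ε) * ‖x‖ ^ 2) ((1 + ε) * ‖x‖ ^ 2)}

end JL

end

open scoped ENNReal Pointwise

namespace JL

/-! Both column laws live on unit vectors and satisfy `E exp⟨w, z⟩ ≤ exp(‖w‖² / (2m))`; these two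
facts alone give the concentration. Put `S = ∑ xⱼ²`. Expanding `‖c z + w‖² = c² + 2c⟨z, w⟩ + ‖w‖²`
and integrating out one column replaces `l` by `l + 2 l² c² / m` in front of `‖w‖²`. Iterating over
the columns gives `E exp(l ‖Πx‖²) ≤ exp(l S + 4 l² S² / m)` for `|l| S ≤ m / 4`, and Chernoff bounds
each tail by `exp(-m ε² / 16)`.

For the cube, the sub-Gaussian bound is `cosh t ≤ exp(t² / 2)` in each coordinate. For the sphere it
follows from the cube by rotation invariance and Fubini. -/

/-- A distribution on unit vectors of `ℝ^m` that is sub-Gaussian with variance proxy `1 / m`. -/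
structure IsSubgaussianUnit {m : ℕ} (P : Measure (EuclideanSpace ℝ (Fin m))) : Prop where
  isProbabilityMeasure : IsProbabilityMeasure P
  norm_eq_one : ∀ᵐ z ∂P, ‖z‖ = 1
  lintegral_exp_inner_le : ∀ w, ∫⁻ z, ENNReal.ofReal (Real.exp (inner ℝ w z)) ∂P ≤
    ENNReal.ofReal (Real.exp (‖w‖ ^ 2 / (2 * m)))

variable {m : ℕ}

/-! ### Concentration for sub-Gaussian columns -/

/-- Inductive step for the exponent, with `r = 1 / m`, `a` the square of the removed coefficient and
`s` the sum of the remaining squares: the updated parameter stays admissible, and the accumulated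
error fits in the factor 4. -/
theorem exponent_step_le {r a s l : ℝ} (hr : 0 ≤ r) (ha : 0 ≤ a) (hs : 0 ≤ s)
    (hl : |l| * (a + s) * r ≤ 1 / 4) :
    |l + 2 * l ^ 2 * a * r| * s * r ≤ 1 / 4 ∧
      l * a + ((l + 2 * l ^ 2 * a * r) * s + 4 * (l + 2 * l ^ 2 * a * r) ^ 2 * s ^ 2 * r) ≤
        l * (a + s) + 4 * l ^ 2 * (a + s) ^ 2 * r := by
  have habs : |l + 2 * l ^ 2 * a * r| ≤ |l| * (1 + 2 * |l| * a * r) := by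
    refine (abs_add_le _ _).trans (le_of_eq ?_)
    rw [abs_of_nonneg (a := 2 * l ^ 2 * a * r) (by positivity), ← sq_abs l]
    ring
  have hl0 := abs_nonneg l
  have hu : 0 ≤ |l| * a * r := by positivity
  have hv : 0 ≤ |l| * s * r := by positivity
  have hsum : |l| * a * r + |l| * s * r ≤ 1 / 4 := by linarith
  constructor
  · calc |l + 2 * l ^ 2 * a * r| * s * r ≤ |l| * (1 + 2 * |l| * a * r) * s * r := by gcongr
      _ = |l| * s * r * (1 + 2 * (|l| * a * r)) := by ring
      _ ≤ 1 / 4 := by nlinarith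
  · have hsq : (l + 2 * l ^ 2 * a * r) ^ 2 ≤ l ^ 2 * (1 + 2 * (|l| * a * r)) ^ 2 := by
      rw [← sq_abs (l + _)]
      calc _ ≤ (|l| * (1 + 2 * |l| * a * r)) ^ 2 := by gcongr
        _ = _ := by rw [mul_pow, sq_abs]; ring
    have hpoly : 2 * a * s + 4 * (1 + 2 * (|l| * a * r)) ^ 2 * s ^ 2 ≤ 4 * (a + s) ^ 2 := by
      -- Trade `(|l| a r) s` for `(|l| s r) a`, whose first factor is at most 1/4.
      have h1 : |l| * a * r * s ^ 2 ≤ 1 / 4 * (a * s) := by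
        have : |l| * s * r * (a * s) ≤ 1 / 4 * (a * s) := by
          apply mul_le_mul_of_nonneg_right _ (by positivity); linarith
        linarith
      have h2 : (|l| * a * r) ^ 2 * s ^ 2 ≤ 1 / 16 * a ^ 2 := by
        have : (|l| * s * r) ^ 2 ≤ (1 / 4) ^ 2 := by
          apply pow_le_pow_left₀ hv; linarith
        have := mul_le_mul_of_nonneg_right this (sq_nonneg a)
        linarith
      nlinarith [mul_nonneg ha hs, sq_nonneg a]
    have h3 := mul_le_mul_of_nonneg_right hsq (show 0 ≤ 4 * s ^ 2 * r by positivity)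
    have h4 := mul_le_mul_of_nonneg_right hpoly (show 0 ≤ l ^ 2 * r by positivity)
    nlinarith

theorem IsSubgaussianUnit.lintegral_exp_norm_add_sq_le
    {P : Measure (EuclideanSpace ℝ (Fin m))} (hP : IsSubgaussianUnit P) (l c : ℝ)
    (w : EuclideanSpace ℝ (Fin m)) :
    ∫⁻ z, ENNReal.ofReal (Real.exp (l * ‖c • z + w‖ ^ 2)) ∂P ≤
      ENNReal.ofReal (Real.exp (l * c ^ 2)) *
        ENNReal.ofReal (Real.exp ((l + 2 * l ^ 2 * c ^ 2 * (m : ℝ)⁻¹) * ‖w‖ ^ 2)) := by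
  have hcongr : ∫⁻ z, ENNReal.ofReal (Real.exp (l * ‖c • z + w‖ ^ 2)) ∂P =
      ∫⁻ z, ENNReal.ofReal (Real.exp (l * c ^ 2 + l * ‖w‖ ^ 2)) *
        ENNReal.ofReal (Real.exp (inner ℝ ((2 * l * c) • w) z)) ∂P := by
    refine lintegral_congr_ae ?_
    filter_upwards [hP.norm_eq_one] with z hz
    rw [← ENNReal.ofReal_mul (by positivity), ← Real.exp_add]
    congr 2
    rw [norm_add_sq_real, norm_smul, hz, inner_smul_left, inner_smul_left, real_inner_comm,
      Real.norm_eq_abs, mul_one, sq_abs]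
    simp only [conj_trivial]
    ring
  rw [hcongr, lintegral_const_mul _ (by fun_prop)]
  refine (mul_le_mul_right (hP.lintegral_exp_inner_le _) _).trans (le_of_eq ?_)
  rw [← ENNReal.ofReal_mul (by positivity), ← ENNReal.ofReal_mul (by positivity),
    ← Real.exp_add, ← Real.exp_add]
  congr 2
  rw [norm_smul, Real.norm_eq_abs, mul_pow, sq_abs, div_eq_mul_inv, mul_inv]
  ring

/-- Induction on the number of columns with `l` universally quantified, since the parameter changes
when a column is integrated out. -/
theorem IsSubgaussianUnit.lintegral_exp_norm_sum_sq_le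
    {P : Measure (EuclideanSpace ℝ (Fin m))} (hP : IsSubgaussianUnit P) :
    ∀ (n : ℕ) (x : Fin n → ℝ) (l : ℝ), |l| * (∑ j, x j ^ 2) * (m : ℝ)⁻¹ ≤ 1 / 4 →
      ∫⁻ z, ENNReal.ofReal (Real.exp (l * ‖∑ j, x j • z j‖ ^ 2)) ∂(Measure.pi fun _ : Fin n => P) ≤
        ENNReal.ofReal (Real.exp (l * (∑ j, x j ^ 2) +
          4 * l ^ 2 * (∑ j, x j ^ 2) ^ 2 * (m : ℝ)⁻¹))
  | 0, x, l, _ => by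
    have := hP.isProbabilityMeasure
    simp
  | n + 1, x, l, hl => by
    have := hP.isProbabilityMeasure
    rw [Fin.sum_univ_succ] at hl ⊢
    have hs : 0 ≤ ∑ j : Fin n, x j.succ ^ 2 := Finset.sum_nonneg fun _ _ => sq_nonneg _
    obtain ⟨hl', hle⟩ := exponent_step_le (inv_nonneg.2 (Nat.cast_nonneg m)) (sq_nonneg (x 0)) hs hl
    have ih := hP.lintegral_exp_norm_sum_sq_le n (fun j => x j.succ) _ hl'
    rw [← ((measurePreserving_piFinSuccAbove (fun _ : Fin (n + 1) => P) 0).symm).lintegral_comp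
      (by fun_prop), lintegral_prod_symm' _ (by fun_prop)]
    calc _ = ∫⁻ y, ∫⁻ z, ENNReal.ofReal (Real.exp (l * ‖x 0 • z + ∑ j, x j.succ • y j‖ ^ 2)) ∂P
            ∂(Measure.pi fun _ : Fin n => P) := by
          simp [Fin.sum_univ_succ, MeasurableEquiv.piFinSuccAbove]
      _ ≤ _ := lintegral_mono fun y => hP.lintegral_exp_norm_add_sq_le l (x 0) _
      _ ≤ _ := by
        rw [lintegral_const_mul _ (by fun_prop)]
        refine (mul_le_mul_right ih _).trans ?_
        rw [← ENNReal.ofReal_mul (by positivity), ← Real.exp_add]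
        exact ENNReal.ofReal_le_ofReal (Real.exp_le_exp.2 hle)

theorem measurable_ofColumns {n : ℕ} :
    Measurable (ofColumns : (Fin n → EuclideanSpace ℝ (Fin m)) → Matrix (Fin m) (Fin n) ℝ) := by
  refine measurable_pi_lambda _ fun i => measurable_pi_lambda _ fun j => ?_
  simp only [ofColumns, Matrix.of_apply]
  fun_prop

theorem toLp_ofColumns_mulVec {n : ℕ} (z : Fin n → EuclideanSpace ℝ (Fin m)) (x : Fin n → ℝ) :
    WithLp.toLp 2 ((ofColumns z).mulVec x) = ∑ j, x j • z j := by
  ext i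
  simp [ofColumns, Matrix.mulVec, dotProduct, mul_comm]

theorem measure_le_of_lintegral_exp_le {Ω : Type*} [MeasurableSpace Ω] {μ : Measure Ω}
    {f : Ω → ℝ} (hf : Measurable f) {a b : ℝ}
    (h : ∫⁻ ω, ENNReal.ofReal (Real.exp (f ω)) ∂μ ≤ ENNReal.ofReal (Real.exp b)) :
    μ {ω | a ≤ f ω} ≤ ENNReal.ofReal (Real.exp (b - a)) := by
  have hmarkov := mul_meas_ge_le_lintegral (μ := μ)
    (f := fun ω => ENNReal.ofReal (Real.exp (f ω))) (by fun_prop) (ENNReal.ofReal (Real.exp a))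
  simp only [ENNReal.ofReal_le_ofReal_iff (Real.exp_pos _).le, Real.exp_le_exp] at hmarkov
  calc μ {ω | a ≤ f ω}
      = ENNReal.ofReal (Real.exp (-a)) * (ENNReal.ofReal (Real.exp a) * μ {ω | a ≤ f ω}) := by
        rw [← mul_assoc, ← ENNReal.ofReal_mul (Real.exp_pos _).le, ← Real.exp_add]
        simp
    _ ≤ ENNReal.ofReal (Real.exp (-a)) * ENNReal.ofReal (Real.exp b) := by
        gcongr
        exact hmarkov.trans h
    _ = ENNReal.ofReal (Real.exp (b - a)) := by
        rw [← ENNReal.ofReal_mul (Real.exp_pos _).le, ← Real.exp_add]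
        ring_nf

/-- The sign `σ = ±1` treats the upper and lower tails at once, by Chernoff with parameter `t σ`. -/
theorem IsSubgaussianUnit.measure_tail_le
    {P : Measure (EuclideanSpace ℝ (Fin m))} (hP : IsSubgaussianUnit P) (hm : 0 < m) {n : ℕ}
    {x : Fin n → ℝ} (hx : 0 < ∑ j, x j ^ 2) {ε σ : ℝ} (hε : 0 < ε) (hε1 : ε < 1)
    (hσ : |σ| = 1) :
    Measure.pi (fun _ : Fin n => P)
        {z | (1 + σ * ε) * (∑ j, x j ^ 2) * σ ≤ ‖∑ j, x j • z j‖ ^ 2 * σ} ≤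
      ENNReal.ofReal (Real.exp (-(m * ε ^ 2 / 16))) := by
  set S := ∑ j, x j ^ 2
  have hm' : (0 : ℝ) < m := Nat.cast_pos.2 hm
  -- This `t` minimizes the Chernoff exponent `4 (t S)² / m - t S ε`.
  set t : ℝ := ε * m / (8 * S) with ht
  have ht0 : 0 < t := by positivity
  have hσ2 : σ ^ 2 = 1 := by rw [← sq_abs, hσ, one_pow]
  have htS : t * S = ε * m / 8 := by rw [ht]; field_simp
  have hcond : |t * σ| * S * (m : ℝ)⁻¹ ≤ 1 / 4 := by
    rw [abs_mul, hσ, mul_one, abs_of_pos ht0, htS]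
    field_simp
    linarith
  have key := measure_le_of_lintegral_exp_le (a := t * σ * ((1 + σ * ε) * S))
    (by fun_prop) (hP.lintegral_exp_norm_sum_sq_le n x (t * σ) hcond)
  refine (measure_mono fun z hz => ?_).trans (key.trans (le_of_eq ?_))
  · have := mul_le_mul_of_nonneg_left (Set.mem_ofPred.1 hz) ht0.le
    simp only [Set.mem_ofPred_eq]
    linarith
  · congr 2
    have : t * σ * S + 4 * (t * σ) ^ 2 * S ^ 2 * (m : ℝ)⁻¹ - t * σ * ((1 + σ * ε) * S) =
        σ ^ 2 * (4 * (t * S) ^ 2 * (m : ℝ)⁻¹ - t * S * ε) := by ring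
    rw [this, hσ2, htS]
    field_simp
    ring

theorem IsSubgaussianUnit.isJLDistribution_iidColumns
    {P : Measure (EuclideanSpace ℝ (Fin m))} (hP : IsSubgaussianUnit P) (hm : 0 < m) (n : ℕ)
    {ε δ : ℝ} (hε : 0 < ε) (hε1 : ε < 1) (hδ : 0 < δ)
    (h : 16 * (ε ^ 2)⁻¹ * Real.log (2 / δ) ≤ m) :
    IsJLDistribution ε δ (iidColumns n P) := by
  have := hP.isProbabilityMeasure
  have hprob : IsProbabilityMeasure (iidColumns n P) :=
    Measure.isProbabilityMeasure_map measurable_ofColumns.aemeasurable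
  refine ⟨hprob, fun x => ?_⟩
  have hmeas : MeasurableSet {M : Matrix (Fin m) (Fin n) ℝ |
      ‖(WithLp.toLp 2 (M.mulVec x.ofLp) : EuclideanSpace ℝ (Fin m))‖ ^ 2 ∈
        Set.Icc ((1 - ε) * ‖x‖ ^ 2) ((1 + ε) * ‖x‖ ^ 2)} := by
    refine measurableSet_Icc.preimage ?_
    refine (Measurable.norm ?_).pow_const 2
    refine (WithLp.measurable_toLp 2 _).comp (measurable_pi_lambda _ fun i => ?_)
    simp only [Matrix.mulVec, dotProduct]
    exact Finset.measurable_sum _ fun j _ =>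
      ((measurable_pi_apply (X := fun _ => ℝ) j).comp
        (measurable_pi_apply (X := fun _ => Fin n → ℝ) i)).mul_const _
  rw [sub_le_comm, ← probReal_compl_eq_one_sub hmeas, iidColumns,
    map_measureReal_apply measurable_ofColumns hmeas.compl]
  have hnorm : ‖x‖ ^ 2 = ∑ j, x j ^ 2 := by simp [EuclideanSpace.norm_sq_eq]
  -- The tail bound needs `S > 0`; for `x = 0` the failure event is empty.
  rcases (Finset.sum_nonneg fun j _ => sq_nonneg (x j) : 0 ≤ ∑ j, x j ^ 2).eq_or_lt with h0 | hpos
  · have hx : x = 0 := by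
      rw [← norm_eq_zero, ← sq_eq_zero_iff, hnorm, ← h0]
    simp [hx, hδ.le]
  have hexp : Real.exp (-(m * ε ^ 2 / 16)) ≤ δ / 2 := by
    rw [← Real.le_log_iff_exp_le (by positivity), ← inv_div 2 δ, Real.log_inv, neg_le_neg_iff]
    have := mul_le_mul_of_nonneg_right h (sq_nonneg ε)
    have h2 : 16 * (ε ^ 2)⁻¹ * Real.log (2 / δ) * ε ^ 2 = 16 * Real.log (2 / δ) := by field_simp
    linarith
  have hup := hP.measure_tail_le hm hpos hε hε1 (σ := 1) (by simp)
  have hlow := hP.measure_tail_le hm hpos hε hε1 (σ := -1) (by simp)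
  refine ENNReal.toReal_le_of_le_ofReal hδ.le ?_
  calc _ ≤ _ := measure_mono ?_
    _ ≤ _ := measure_union_le _ _
    _ ≤ _ := add_le_add hup hlow
    _ ≤ ENNReal.ofReal δ := by
      rw [← ENNReal.ofReal_add (by positivity) (by positivity)]
      exact ENNReal.ofReal_le_ofReal (by linarith)
  intro z hz
  simp only [Set.mem_preimage, Set.mem_compl_iff, Set.mem_ofPred_eq, toLp_ofColumns_mulVec,
    Set.mem_Icc, not_and_or, not_le, hnorm] at hz
  simp only [Set.mem_union, Set.mem_ofPred_eq]
  rcases hz with hz | hz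
  · right; linarith
  · left; linarith

/-! ### The scaled cube -/

/-- The sign vectors as a finite set. -/
noncomputable def signFinset (m : ℕ) : Finset (EuclideanSpace ℝ (Fin m)) :=
  (Fintype.piFinset fun _ : Fin m => ({1, -1} : Finset ℝ)).map
    (WithLp.equiv 2 (Fin m → ℝ)).symm.toEmbedding

theorem coe_signFinset (m : ℕ) : (signFinset m : Set (EuclideanSpace ℝ (Fin m))) = signCube m := by
  ext v
  simp only [signFinset, signCube, Finset.coe_map, Set.mem_image, Finset.mem_coe,
    Fintype.mem_piFinset, Finset.mem_insert, Finset.mem_singleton, Set.mem_ofPred_eq]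
  constructor
  · rintro ⟨y, hy, rfl⟩
    exact hy
  · intro hv
    exact ⟨v.ofLp, hv, rfl⟩

theorem card_signFinset (m : ℕ) : (signFinset m).card = 2 ^ m := by
  have : ({1, -1} : Finset ℝ).card = 2 := Finset.card_pair (by norm_num)
  simp [signFinset, this]

instance isProbabilityMeasure_uniformScaledCube (m : ℕ) :
    IsProbabilityMeasure (uniformScaledCube m) := by
  have : IsProbabilityMeasure (uniformOn (signCube m)) := by
    rw [← coe_signFinset]
    refine isProbabilityMeasure_uniformOn (Finset.finite_toSet _) ?_
    rw [Finset.coe_nonempty, ← Finset.card_pos, card_signFinset]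
    positivity
  exact Measure.isProbabilityMeasure_map (by fun_prop)

theorem norm_eq_one_ae_uniformScaledCube (hm : 0 < m) :
    ∀ᵐ z ∂(uniformScaledCube m), ‖z‖ = 1 := by
  rw [uniformScaledCube, ae_map_iff (by fun_prop)
    (isClosed_eq continuous_norm continuous_const).measurableSet]
  have hmem : ∀ᵐ v ∂(uniformOn (signCube m)), v ∈ signCube m :=
    ae_cond_mem (by rw [← coe_signFinset]; exact (Finset.finite_toSet _).measurableSet)
  filter_upwards [hmem] with v hv
  have hv2 : ‖v‖ ^ 2 = m := by
    have : ∀ i, v i ^ 2 = 1 := fun i => by rcases hv i with h | h <;> simp [h]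
    simp [EuclideanSpace.norm_sq_eq, this]
  have hvn : ‖v‖ = Real.sqrt m := by rw [← hv2, Real.sqrt_sq (norm_nonneg v)]
  have : 0 < Real.sqrt m := Real.sqrt_pos.2 (Nat.cast_pos.2 hm)
  rw [norm_smul, hvn, Real.norm_eq_abs, abs_of_pos (by positivity)]
  field_simp

theorem sum_signFinset_exp_inner_le (w : EuclideanSpace ℝ (Fin m)) :
    ∑ v ∈ signFinset m, Real.exp (inner ℝ w v) ≤ 2 ^ m * Real.exp (‖w‖ ^ 2 / 2) := by
  calc ∑ v ∈ signFinset m, Real.exp (inner ℝ w v)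
      = ∑ y ∈ Fintype.piFinset fun _ : Fin m => ({1, -1} : Finset ℝ),
          ∏ i, Real.exp (y i * w i) := by
        rw [signFinset, Finset.sum_map]
        refine Finset.sum_congr rfl fun y _ => ?_
        rw [← Real.exp_sum]
        rfl
    _ = ∏ i, ∑ s ∈ ({1, -1} : Finset ℝ), Real.exp (s * w i) :=
        (Finset.prod_univ_sum (fun _ : Fin m => ({1, -1} : Finset ℝ))
          fun i s => Real.exp (s * w i)).symm
    _ = ∏ i, 2 * Real.cosh (w i) := by
        refine Finset.prod_congr rfl fun i _ => ?_
        rw [Finset.sum_pair (by norm_num), Real.cosh_eq]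
        simp
        ring
    _ ≤ ∏ i, 2 * Real.exp (w i ^ 2 / 2) := by
        refine Finset.prod_le_prod (fun i _ => by positivity) fun i _ => ?_
        gcongr
        exact Real.cosh_le_exp_half_sq _
    _ = 2 ^ m * Real.exp (‖w‖ ^ 2 / 2) := by
        rw [Finset.prod_mul_distrib, ← Real.exp_sum, ← Finset.sum_div, EuclideanSpace.norm_sq_eq]
        simp

theorem lintegral_uniformOn_signCube (f : EuclideanSpace ℝ (Fin m) → ℝ≥0∞) :
    ∫⁻ v, f v ∂(uniformOn (signCube m)) = (2 ^ m : ℝ≥0∞)⁻¹ * ∑ v ∈ signFinset m, f v := by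
  rw [← coe_signFinset, uniformOn, ProbabilityTheory.cond, lintegral_smul_measure, lintegral_finset,
    Measure.count_apply_finset, card_signFinset]
  simp

theorem isSubgaussianUnit_uniformScaledCube (hm : 0 < m) :
    IsSubgaussianUnit (uniformScaledCube m) where
  isProbabilityMeasure := inferInstance
  norm_eq_one := norm_eq_one_ae_uniformScaledCube hm
  lintegral_exp_inner_le w := by
    rw [uniformScaledCube, lintegral_map (by fun_prop) (by fun_prop), lintegral_uniformOn_signCube,
      ← ENNReal.ofReal_sum_of_nonneg fun _ _ => (Real.exp_pos _).le]
    have h := sum_signFinset_exp_inner_le ((1 / Real.sqrt m) • w)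
    simp only [inner_smul_left, conj_trivial] at h
    simp only [inner_smul_right]
    have hsq : ‖(1 / Real.sqrt m) • w‖ ^ 2 / 2 = ‖w‖ ^ 2 / (2 * m) := by
      rw [norm_smul, Real.norm_eq_abs, mul_pow, sq_abs, div_pow, Real.sq_sqrt (Nat.cast_nonneg m)]
      field_simp
    rw [hsq] at h
    calc _ ≤ (2 ^ m : ℝ≥0∞)⁻¹ * ENNReal.ofReal (2 ^ m * Real.exp (‖w‖ ^ 2 / (2 * m))) := by gcongr
      _ = _ := by
        rw [ENNReal.ofReal_mul (by positivity), ENNReal.ofReal_pow (by norm_num), ← mul_assoc,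
          ENNReal.ofReal_ofNat, ENNReal.inv_mul_cancel (by simp) (by simp), one_mul]

/-! ### The sphere -/

theorem isProbabilityMeasure_uniformSphere (hm : 0 < m) :
    IsProbabilityMeasure (uniformSphere m) := by
  have : NeZero m := ⟨hm.ne'⟩
  have h : IsProbabilityMeasure
      (((volume : Measure (EuclideanSpace ℝ (Fin m))).toSphere Set.univ)⁻¹ •
        (volume : Measure (EuclideanSpace ℝ (Fin m))).toSphere) := by
    refine ⟨?_⟩
    rw [Measure.smul_apply, smul_eq_mul]
    exact ENNReal.inv_mul_cancel
      (by rw [Ne, Measure.measure_univ_eq_zero]; exact Measure.toSphere_ne_zero _)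
      (measure_ne_top _ _)
  exact Measure.isProbabilityMeasure_map measurable_subtype_coe.aemeasurable

theorem norm_eq_one_ae_uniformSphere : ∀ᵐ z ∂(uniformSphere m), ‖z‖ = 1 := by
  rw [uniformSphere, ae_map_iff measurable_subtype_coe.aemeasurable
    (isClosed_eq continuous_norm continuous_const).measurableSet]
  exact Filter.Eventually.of_forall fun z => by simp

theorem uniformSphere_apply {A : Set (EuclideanSpace ℝ (Fin m))} (hA : MeasurableSet A) :
    uniformSphere m A = ((volume : Measure (EuclideanSpace ℝ (Fin m))).toSphere Set.univ)⁻¹ *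
      (m * volume (Set.Ioo (0 : ℝ) 1 • (Metric.sphere (0 : EuclideanSpace ℝ (Fin m)) 1 ∩ A))) := by
  rw [uniformSphere, Measure.map_apply measurable_subtype_coe hA, Measure.smul_apply, smul_eq_mul,
    Measure.toSphere_apply' _ (measurable_subtype_coe hA), Subtype.image_preimage_coe]
  simp

/-- The mass of `A` is proportional to the volume of the cone over it; `L` maps cones to cones and
preserves volume. -/
theorem map_uniformSphere (L : EuclideanSpace ℝ (Fin m) ≃ₗᵢ[ℝ] EuclideanSpace ℝ (Fin m)) :
    Measure.map L (uniformSphere m) = uniformSphere m := by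
  ext A hA
  have hL : Measurable L := L.continuous.measurable
  rw [Measure.map_apply hL hA, uniformSphere_apply (hL hA), uniformSphere_apply hA]
  congr 2
  have hset : Set.Ioo (0 : ℝ) 1 • (Metric.sphere (0 : EuclideanSpace ℝ (Fin m)) 1 ∩ L ⁻¹' A) =
      L ⁻¹' (Set.Ioo (0 : ℝ) 1 • (Metric.sphere (0 : EuclideanSpace ℝ (Fin m)) 1 ∩ A)) := by
    ext y
    simp only [Set.mem_smul, Set.mem_preimage, Set.mem_inter_iff, mem_sphere_zero_iff_norm]
    constructor
    · rintro ⟨r, hr, z, ⟨hz, hzA⟩, rfl⟩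
      exact ⟨r, hr, L z, ⟨by simpa using hz, hzA⟩, by simp⟩
    · rintro ⟨r, hr, z, ⟨hz, hzA⟩, h⟩
      exact ⟨r, hr, L.symm z, ⟨by simpa using hz, by simpa using hzA⟩, L.injective (by simpa using h)⟩
  rw [hset]
  exact L.measurePreserving.measure_preimage_equiv (f := L.toHomeomorph.toMeasurableEquiv) _

theorem lintegral_exp_inner_uniformSphere_congr {v w : EuclideanSpace ℝ (Fin m)}
    (h : ‖v‖ = ‖w‖) :
    ∫⁻ z, ENNReal.ofReal (Real.exp (inner ℝ v z)) ∂(uniformSphere m) =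
      ∫⁻ z, ENNReal.ofReal (Real.exp (inner ℝ w z)) ∂(uniformSphere m) := by
  -- Vectors of equal norm are exchanged by the reflection in the hyperplane orthogonal to their
  -- difference.
  set L := (ℝ ∙ (v - w))ᗮ.reflection
  have hL : L v = w := Submodule.reflection_sub h
  conv_rhs => rw [← map_uniformSphere L, lintegral_map (by fun_prop) L.continuous.measurable, ← hL]
  simp only [LinearIsometryEquiv.inner_map_map]

/-- The integral depends only on `‖w‖`, so `w` may be replaced by `‖w‖ • v` and averaged over `v` in
the scaled cube. After swapping integrals, each unit `z` is handled by the cube bound at `‖w‖ • z`.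
-/
theorem isSubgaussianUnit_uniformSphere (hm : 0 < m) : IsSubgaussianUnit (uniformSphere m) where
  isProbabilityMeasure := isProbabilityMeasure_uniformSphere hm
  norm_eq_one := norm_eq_one_ae_uniformSphere
  lintegral_exp_inner_le w := by
    have := isProbabilityMeasure_uniformSphere hm
    have hcube := isSubgaussianUnit_uniformScaledCube hm
    calc ∫⁻ z, ENNReal.ofReal (Real.exp (inner ℝ w z)) ∂(uniformSphere m)
        = ∫⁻ v, ∫⁻ z, ENNReal.ofReal (Real.exp (inner ℝ (‖w‖ • v) z)) ∂(uniformSphere m)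
            ∂(uniformScaledCube m) := by
          rw [← mul_one (lintegral _ _), ← measure_univ (μ := uniformScaledCube m),
            ← lintegral_const]
          refine lintegral_congr_ae ?_
          filter_upwards [hcube.norm_eq_one] with v hv
          exact lintegral_exp_inner_uniformSphere_congr (by simp [norm_smul, hv])
      _ = ∫⁻ z, ∫⁻ v, ENNReal.ofReal (Real.exp (inner ℝ (‖w‖ • v) z)) ∂(uniformScaledCube m)
            ∂(uniformSphere m) := lintegral_lintegral_swap (by fun_prop)
      _ ≤ ∫⁻ _, ENNReal.ofReal (Real.exp (‖w‖ ^ 2 / (2 * m))) ∂(uniformSphere m) := by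
          refine lintegral_mono_ae ?_
          filter_upwards [norm_eq_one_ae_uniformSphere] with z hz
          have h := hcube.lintegral_exp_inner_le (‖w‖ • z)
          rw [norm_smul, hz, mul_one, norm_norm] at h
          refine (lintegral_congr fun v => ?_).trans_le h
          rw [inner_smul_left, inner_smul_left, real_inner_comm]
      _ = ENNReal.ofReal (Real.exp (‖w‖ ^ 2 / (2 * m))) := by simp

/-! ### The dimension bound -/

theorem ceil_dimension_le {ε δ : ℝ} (hε : 0 < ε) (hε2 : ε < 1 / 2) (hδ : 0 < δ)
    (hδ2 : δ < 1 / 2) :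
    -- As `log 2 ≤ log (1 / δ)`, the quantity under the ceiling is at most `128 ε⁻² log (1 / δ)`;
    -- the remaining 2 absorbs the `+ 1` from rounding up.
    (⌈64 * (ε ^ 2)⁻¹ * Real.log (2 / δ)⌉₊ : ℝ) ≤ 130 * (ε ^ 2)⁻¹ * Real.log (1 / δ) := by
  have hlog : Real.log (2 / δ) = Real.log 2 + Real.log (1 / δ) := by
    rw [← Real.log_mul (by norm_num) (by positivity)]
    ring_nf
  have hle : Real.log 2 ≤ Real.log (1 / δ) :=
    Real.log_le_log (by norm_num) (by rw [le_div_iff₀ hδ]; linarith)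
  have h2 := Real.log_two_gt_d9
  have hinv : 4 ≤ (ε ^ 2)⁻¹ := by
    rw [le_inv_comm₀ (by norm_num) (by positivity)]
    nlinarith
  have hpos : 0 < Real.log 2 + Real.log (1 / δ) := by linarith
  have hceil := Nat.ceil_lt_add_one
    (show 0 ≤ 64 * (ε ^ 2)⁻¹ * Real.log (2 / δ) by rw [hlog]; positivity)
  rw [hlog] at hceil ⊢
  have h3 : (ε ^ 2)⁻¹ * Real.log 2 ≤ (ε ^ 2)⁻¹ * Real.log (1 / δ) := by gcongr
  nlinarith

end JL

theorem mainTheorem2 :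
    (∀ (m n : ℕ) (ε δ : ℝ), 0 < ε → ε < 1 → 0 < δ → δ < 1 →
      64 * (ε ^ 2)⁻¹ * Real.log (2 / δ) ≤ (m : ℝ) →
        JL.IsJLDistribution ε δ (JL.binaryCoinConstruction m n) ∧
        JL.IsJLDistribution ε δ (JL.sphericalConstruction m n)) ∧
    (∃ C : ℝ, ∀ ε δ : ℝ, 0 < ε → ε < 1 / 2 → 0 < δ → δ < 1 / 2 →
      (⌈64 * (ε ^ 2)⁻¹ * Real.log (2 / δ)⌉₊ : ℝ) ≤ C * (ε ^ 2)⁻¹ * Real.log (1 / δ)) := by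
  refine ⟨fun m n ε δ hε hε1 hδ hδ1 h => ?_, 130, fun ε δ => JL.ceil_dimension_le⟩
  have hlog : 0 < Real.log (2 / δ) := Real.log_pos (by rw [lt_div_iff₀ hδ]; linarith)
  have hpos : 0 < (ε ^ 2)⁻¹ * Real.log (2 / δ) := by positivity
  have hm : 0 < m := by
    have : (0 : ℝ) < m := by linarith
    exact_mod_cast this
  -- The concentration argument only needs the constant 16.
  have h16 : 16 * (ε ^ 2)⁻¹ * Real.log (2 / δ) ≤ m := by linarith
  exact ⟨(JL.isSubgaussianUnit_uniformScaledCube hm).isJLDistribution_iidColumns hm n hε hε1 hδ h16,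
    (JL.isSubgaussianUnit_uniformSphere hm).isJLDistribution_iidColumns hm n hε hε1 hδ h16⟩
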